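/- Let $\mathcal{X}$ be a finite non-empty alphabet, $\mathcal{H}=\mathbb{C}^d$ a finite-dimensional Hilbert space with set of density operators $\mathcal{S}(\mathcal{H})$, let $\mathcal{W}=\{W_x\}_{x\in\mathcal{X}}\subset\mathcal{S}(\mathcal{H})$ be a classical-quantum channel, and let $M\ge 1$ be an integer. Write $\mathcal{P}(\mathcal{X})$ for the probability distributions on $\mathcal{X}$, $A\wedge B:=\tfrac12(A+B-|A-B|)$ for Hermitian $A,B$, and $\mathcal{I}_2=\{|i\rangle\langle i|\}_{i\in\{1,2\}}$ for the perfect one-bit channel, so that $\mathcal{W}\otimes\mathcal{I}_2=\{W_x\otimes|i\rangle\langle i|\}_{(x,i)}$. The meta-converse error probability is $$\varepsilon^{\mathrm{MC}}(M,\mathcal{W}):=\inf\Big\{\varepsilon\in[0,1] : \sup_{p\in\mathcal{P}(\mathcal{X})}\inf_{\sigma\in\mathcal{S}(\mathcal{H})}D_H^{\varepsilon}\big(p\circ\mathcal{W}\,\big\|\,p\otimes\sigma\big)\ge\log M\Big\},$$ where $p\circ\mathcal{W}=\sum_x p(x)|x\rangle\langle x|\otimes W_x$, $p\otimes\sigma=\sum_x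 p(x)|x\rangle\langle x|\otimes\sigma$ and $D_H^{\varepsilon}(\rho\|\sigma)=-\log\min\{\mathrm{Tr}[\sigma O] : 0\preccurlyeq O\preccurlyeq\mathbb{I},\ \mathrm{Tr}[\rho O]\ge 1-\varepsilon\}$ (with $-\log 0=+\infty$). The non-signaling error probability is $$\varepsilon^{\mathrm{NS}}(M,\mathcal{W}):=1-\sup_{\Pi}\frac1M\sum_{m=1}^M\langle m|\,\Pi(\mathcal{W})(|m\rangle\langle m|)\,|m\rangle,$$ where the supremum is over non-signaling super-channels: bipartite quantum channels $\Pi$ with inputs $A_i$ (Alice), $B_i$ (Bob) and outputs $A_o$ (Alice), $B_o$ (Bob), where $A_i=B_o=\mathbb{C}^M$, $A_o=\mathbb{C}^{\mathcal{X}}$, $B_i=\mathcal{H}$, whose Choi matrix $J\succcurlyeq0$ satisfies $J_{A_iB_i}=\mathbb{I}$, $J_{A_iB_iB_o}=\mathbb{I}_{A_i}\otimes K_{B_iB_o}$ and $J_{A_iA_oB_i}=L_{A_iA_o}\otimes\mathbb{I}_{B_i}$ for some matrices $K,L$; and $\Pi(\mathcal{W})$ is the map from $A_i$ to $B_o$ obtained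 by inserting the channel $\rho\mapsto\sum_x\langle x|\rho|x\rangle W_x$ between $A_o$ and $B_i$. Then $$\varepsilon^{\mathrm{NS}}(2M,\mathcal{W}\otimes\mathcal{I}_2)=\varepsilon^{\mathrm{MC}}(M,\mathcal{W})=\inf_{p\in\mathcal{P}(\mathcal{X})}\ \sup_{B\succcurlyeq0}\ \Big\{\sum_{x\in\mathcal{X}}p(x)\,\mathrm{Tr}[W_x\wedge MB]-\mathrm{Tr}[B]\Big\},$$ $$\varepsilon^{\mathrm{NS}}(M,\mathcal{W})=\inf_{p\in\mathcal{P}(\mathcal{X})}\ \sup_{B=B^\dagger}\ \Big\{\sum_{x\in\mathcal{X}}p(x)\,\mathrm{Tr}[W_x\wedge MB]-\mathrm{Tr}[B]\Big\},$$ where $B$ ranges over the positive semi-definite, respectively the Hermitian, operators on $\mathcal{H}$. -/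

import Mathlib

open scoped Kronecker ComplexOrder

noncomputable section

namespace CQ

open Matrix

/-- The set of density operators on the Hilbert space `ℂ^d`. -/
def densityMatrices (d : Type*) [Fintype d] : Set (Matrix d d ℂ) :=
  {ρ | ρ.PosSemidef ∧ ρ.trace = 1}

/-- A classical-quantum channel with alphabet `X` and output space `ℂ^d`. -/
structure CQChannel (X d : Type*) [Fintype d] where
  /-- the output state `W_x` -/
  state : X → Matrix d d ℂ
  state_mem : ∀ x, state x ∈ densityMatrices d

/-- The tensor product of two classical-quantum channels, `(x, y) ↦ W_x ⊗ V_y`. -/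
def CQChannel.tensor {X Y d e : Type*} [Fintype d] [Fintype e]
    (W : CQChannel X d) (V : CQChannel Y e) : CQChannel (X × Y) (d × e) where
  state z := W.state z.1 ⊗ₖ V.state z.2
  state_mem z := by
    refine ⟨(W.state_mem z.1).1.kronecker (V.state_mem z.2).1, ?_⟩
    rw [trace_kronecker, (W.state_mem z.1).2, (V.state_mem z.2).2, one_mul]

/-- The perfect one-bit channel `I₂`, `i ↦ |i⟩⟨i|`. -/
def bitChannel : CQChannel (Fin 2) (Fin 2) where
  state i := single i i 1
  state_mem i := by
    refine ⟨?_, by simp⟩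
    rw [← diagonal_single]
    refine PosSemidef.diagonal fun j => ?_
    by_cases h : j = i
    · subst h; simp
    · simp [h]

/-- The classical-quantum channel as a quantum channel, `ρ ↦ ∑ x, ⟨x|ρ|x⟩ W_x`. -/
def CQChannel.toMap {X d : Type*} [Fintype X] [Fintype d] (W : CQChannel X d) :
    Matrix X X ℂ →ₗ[ℂ] Matrix d d ℂ where
  toFun ρ := ∑ x, ρ x x • W.state x
  map_add' ρ τ := by simp [add_smul, Finset.sum_add_distrib]
  map_smul' c ρ := by simp [mul_smul, Finset.smul_sum]

/-- The noncommutative minimum `A ∧ B = (A + B - |A - B|) / 2` of two Hermitian matrices, where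
`|·|` is applied through the spectral decomposition. -/
def ncMin {d : Type*} [Fintype d] [DecidableEq d] (A B : Matrix d d ℂ) : Matrix d d ℂ :=
  (1 / 2 : ℂ) • (A + B - cfc (fun t : ℝ => |t|) (A - B))

section MetaConverse

/-- The hypothesis testing relative entropy
`D_H^ε(ρ‖σ) = -log min {Tr σO | 0 ≼ O ≼ 1, Tr ρO ≥ 1 - ε}`, for `0 ≤ ε ≤ 1`, with
values in the extended reals (`-log 0 = +∞`). -/
def hypothesisTestingEntropy {n : Type*} [Fintype n] [DecidableEq n] (ε : ℝ)
    (ρ σ : Matrix n n ℂ) : EReal :=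
  -ENNReal.log (ENNReal.ofReal (sInf {t : ℝ | ∃ O : Matrix n n ℂ,
    O.PosSemidef ∧ (1 - O).PosSemidef ∧ 1 - ε ≤ (ρ * O).trace.re ∧ t = (σ * O).trace.re}))

/-- The classical-quantum state `p ∘ W = ∑ x, p(x) |x⟩⟨x| ⊗ W_x`. -/
def cqState {X d : Type*} [Fintype X] [DecidableEq X] [Fintype d] (p : X → ℝ)
    (W : CQChannel X d) : Matrix (X × d) (X × d) ℂ :=
  ∑ x, (p x : ℂ) • (single x x (1 : ℂ) ⊗ₖ W.state x)

/-- The product state `p ⊗ σ`, where `p = ∑ x, p(x) |x⟩⟨x|`. -/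
def prodState {X d : Type*} [DecidableEq X] (p : X → ℝ) (σ : Matrix d d ℂ) :
    Matrix (X × d) (X × d) ℂ :=
  diagonal (fun x => (p x : ℂ)) ⊗ₖ σ

/-- The meta-converse error probability
`ε^MC(M, W) = inf {ε | sup_p inf_σ D_H^ε(p ∘ W ‖ p ⊗ σ) ≥ log M}`. -/
def epsMC {X d : Type*} [Fintype X] [DecidableEq X] [Fintype d] [DecidableEq d]
    (M : ℕ) (W : CQChannel X d) : ℝ :=
  sInf {ε : ℝ | ε ∈ Set.Icc (0 : ℝ) 1 ∧
    ((Real.log M : ℝ) : EReal) ≤ ⨆ p : stdSimplex ℝ X, ⨅ σ : densityMatrices d,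
      hypothesisTestingEntropy ε (cqState p W) (prodState p (σ : Matrix d d ℂ))}

end MetaConverse

section NonSignaling

variable {Ai Ao Bi Bo : Type*}

/-- The marginal `J_{A_i B_i B_o}` of `J_{A_i A_o B_i B_o}`. -/
def traceAo [Fintype Ao] (J : Matrix (Ai × Ao × Bi × Bo) (Ai × Ao × Bi × Bo) ℂ) :
    Matrix (Ai × Bi × Bo) (Ai × Bi × Bo) ℂ :=
  of fun i j => ∑ a, J (i.1, a, i.2.1, i.2.2) (j.1, a, j.2.1, j.2.2)

/-- The marginal `J_{A_i A_o B_i}` of `J_{A_i A_o B_i B_o}`. -/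
def traceBo [Fintype Bo] (J : Matrix (Ai × Ao × Bi × Bo) (Ai × Ao × Bi × Bo) ℂ) :
    Matrix ((Ai × Ao) × Bi) ((Ai × Ao) × Bi) ℂ :=
  of fun i j => ∑ b, J (i.1.1, i.1.2, i.2, b) (j.1.1, j.1.2, j.2, b)

/-- The marginal `J_{A_i B_i}` of `J_{A_i A_o B_i B_o}`. -/
def traceAoBo [Fintype Ao] [Fintype Bo]
    (J : Matrix (Ai × Ao × Bi × Bo) (Ai × Ao × Bi × Bo) ℂ) :
    Matrix (Ai × Bi) (Ai × Bi) ℂ :=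
  of fun i j => ∑ a, ∑ b, J (i.1, a, i.2, b) (j.1, a, j.2, b)

/-- `J` is the Choi matrix `∑ |i⟩⟨j| ⊗ Π(|i⟩⟨j|)` of a non-signaling bipartite quantum channel `Π`
with inputs `A_i` (Alice), `B_i` (Bob) and outputs `A_o` (Alice), `B_o` (Bob): completely
positive, trace preserving, and with no signaling in either direction. -/
structure IsNonSignaling [Fintype Ai] [Fintype Ao] [Fintype Bi] [Fintype Bo]
    [DecidableEq Ai] [DecidableEq Bi]
    (J : Matrix (Ai × Ao × Bi × Bo) (Ai × Ao × Bi × Bo) ℂ) : Prop where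
  posSemidef : J.PosSemidef
  tracePreserving : traceAoBo J = 1
  notAliceToBob : ∃ K : Matrix (Bi × Bo) (Bi × Bo) ℂ, traceAo J = (1 : Matrix Ai Ai ℂ) ⊗ₖ K
  notBobToAlice : ∃ L : Matrix (Ai × Ao) (Ai × Ao) ℂ, traceBo J = L ⊗ₖ (1 : Matrix Bi Bi ℂ)

/-- The effective map `Π(N)` from `A_i` to `B_o`, obtained by inserting the map `N` between
the output `A_o` and the input `B_i` of the bipartite channel `Π` with Choi matrix `J`. -/
def effectiveMap [Fintype Ai] [Fintype Ao] [Fintype Bi] [DecidableEq Ao]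
    (J : Matrix (Ai × Ao × Bi × Bo) (Ai × Ao × Bi × Bo) ℂ)
    (N : Matrix Ao Ao ℂ →ₗ[ℂ] Matrix Bi Bi ℂ) (ρ : Matrix Ai Ai ℂ) : Matrix Bo Bo ℂ :=
  of fun b b' => ∑ i, ∑ i', ∑ a, ∑ a', ∑ c, ∑ c',
    ρ i i' * J (i, a, c, b) (i', a', c', b') * N (single a a' 1) c c'

/-- The optimal non-signaling error probability for sending `M` messages: one minus the supremum,
over non-signaling super-channels `Π`, of `(1/M) ∑ m, ⟨m| Π(W)(|m⟩⟨m|) |m⟩`. -/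
def epsNS {X d : Type*} [Fintype X] [DecidableEq X] [Fintype d] [DecidableEq d]
    (M : ℕ) (W : CQChannel X d) : ℝ :=
  1 - sSup {s : ℝ | ∃ J : Matrix (Fin M × X × d × Fin M) (Fin M × X × d × Fin M) ℂ,
    IsNonSignaling J ∧
      s = (1 / (M : ℝ)) * ∑ m : Fin M, (effectiveMap J W.toMap (single m m 1) m m).re}

end NonSignaling

/-- The objective `∑ x, p(x) Tr[W_x ∧ MB] - Tr B`. -/
def dualObjective {X d : Type*} [Fintype X] [Fintype d] [DecidableEq d]
    (M : ℕ) (W : CQChannel X d) (p : X → ℝ) (B : Matrix d d ℂ) : ℝ :=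
  ∑ x, p x * (ncMin (W.state x) ((M : ℂ) • B)).trace.re - B.trace.re

end CQ

end

/-! All three quantities are values of one semidefinite program. Absorbing the input distribution
into the test, `T x = p x • O x`, makes everything linear: maximise `∑ Tr[W_x T_x]` over `0 ≼ T x ≼
p x`, subject to `M ∑ T x ≼ 1` (meta-converse) or `M ∑ T x = 1` (non-signaling). Both constraints
say that `M ∑ T x - 1` pairs nonpositively with a convex cone `C`, the positive semidefinite or the
Hermitian matrices, so one duality argument (`one_sub_sSup_successValues`) serves both formulas. The
distribution `p` is optimised outermost on both sides; only `T` and `B` are exchanged.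

For fixed `p` and `B` the best `T x` is `p x` times the spectral projection of `W_x - MB` onto its
positive part, which produces the noncommutative minimum. The minimax theorem then gives strong
duality.

`epsNS_eq` identifies the non-signaling value: a Choi matrix matters only through its diagonal
blocks, and averaging these over messages gives `T`; conversely `T` is completed by spreading `p x -
T x` evenly over the wrong outputs. `epsMC_eq` uses a second minimax, over states `σ`, to obtain one
test good against every `σ`. Finally, the perfect bit turns the inequality constraint into an
equality (`successValues_tensor_bitChannel`): the slack is stored in the blocks where input and
output bits disagree, which never count as success. -/

open scoped Kronecker ComplexOrder

noncomputable section

namespace CQ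

open Matrix

/-! ### Minimax by compactness and separation -/

section Minimax

/-- A minimax theorem: `f` is continuous and affine in the first variable, which ranges over a
compact convex set, and concave in the second one. -/
theorem exists_forall_nonpos_of_forall_exists {E F : Type*} [AddCommGroup E] [Module ℝ E]
    [TopologicalSpace E] [AddCommGroup F] [Module ℝ F] {s : Set E} {t : Set F}
    (hsc : IsCompact s) (hs : Convex ℝ s) (ht : t.Nonempty) (f : E → F → ℝ)
    (hcont : ∀ y ∈ t, Continuous fun x => f x y)
    (haff : ∀ y ∈ t, ∀ x x' : E, ∀ a b : ℝ, 0 ≤ a → 0 ≤ b → a + b = 1 →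
      f (a • x + b • x') y = a * f x y + b * f x' y)
    (hconc : ∀ x ∈ s, ConcaveOn ℝ t (f x))
    (h : ∀ y ∈ t, ∃ x ∈ s, f x y ≤ 0) : ∃ x ∈ s, ∀ y ∈ t, f x y ≤ 0 := by
  classical
  by_contra! hne
  -- Compactness leaves finitely many `y`, so separation can be done in the finite-dimensional space
  -- `u → ℝ`.
  obtain ⟨u, hu⟩ := hsc.elim_finite_subfamily_closed
    (fun y : t => {x | f x y ≤ 0}) (fun y => isClosed_le (hcont y y.2) continuous_const) (by
      rw [Set.eq_empty_iff_forall_notMem]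
      rintro x ⟨hx, hx'⟩
      obtain ⟨y, hy, hxy⟩ := hne x hx
      have := Set.mem_iInter.1 hx' ⟨y, hy⟩
      exact absurd hxy (not_lt.2 this))
  obtain ⟨y₀, hy₀⟩ := ht
  obtain ⟨x₀, hx₀, -⟩ := h y₀ hy₀
  let g : E → u → ℝ := fun x i => f x i.1
  have hKc : IsCompact (g '' s) :=
    hsc.image (continuous_pi fun i => hcont _ i.1.2)
  have hK : Convex ℝ (g '' s) := by
    rintro _ ⟨x, hx, rfl⟩ _ ⟨x', hx', rfl⟩ a b ha hb hab
    refine ⟨a • x + b • x', hs hx hx' ha hb hab, ?_⟩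
    ext i
    simp [g, haff _ i.1.2 x x' a b ha hb hab]
  obtain ⟨φ, c, c', h1, h2, h3⟩ := geometric_hahn_banach_closed_compact (convex_Iic (𝕜 := ℝ) (0 : u → ℝ))
    isClosed_Iic hK hKc (by
      rw [Set.disjoint_left]
      rintro _ hv ⟨x, hx, rfl⟩
      have : x ∈ s ∩ ⋂ i ∈ u, {x | f x i ≤ 0} :=
        ⟨hx, Set.mem_iInter₂.2 fun i hi => hv ⟨i, hi⟩⟩
      rw [hu] at this
      exact this)
  have hc : 0 < c := by simpa using h1 0 (by simp)
  have hpos : ∀ x ∈ s, 0 < φ (g x) := fun x hx =>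
    hc.trans (h2.trans (h3 _ ⟨x, hx, rfl⟩))
  let w : u → ℝ := fun i => φ (Pi.single i 1)
  have hφ : ∀ v, φ v = ∑ i, w i * v i := by
    intro v
    conv_lhs => rw [← Finset.univ_sum_single v]
    rw [map_sum]
    refine Finset.sum_congr rfl fun i _ => ?_
    have : Pi.single i (v i) = v i • (Pi.single i 1 : u → ℝ) := by
      rw [← Pi.single_smul]; simp
    rw [this, map_smul, smul_eq_mul, mul_comm]
  have hw : ∀ i, 0 ≤ w i := by
    intro i
    by_contra! hi
    -- With a negative weight this point would lie in the nonpositive orthant and have `φ`-value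
    -- exactly `c`, although `φ < c` there.
    have hmem : (c / w i) • (Pi.single i 1 : u → ℝ) ∈ Set.Iic (0 : u → ℝ) := by
      intro j
      by_cases hj : j = i
      · subst hj
        simpa using div_nonpos_of_nonneg_of_nonpos hc.le hi.le
      · simp [hj]
    have := h1 _ hmem
    rw [map_smul, smul_eq_mul, div_mul_cancel₀ _ hi.ne] at this
    exact lt_irrefl _ this
  have hW : 0 < ∑ i, w i := by
    refine lt_of_le_of_ne (Finset.sum_nonneg fun i _ => hw i) fun h0 => ?_
    have h0' := (Finset.sum_eq_zero_iff_of_nonneg fun i _ => hw i).1 h0.symm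
    have := hpos x₀ hx₀
    rw [hφ, Finset.sum_eq_zero fun i hi => by rw [h0' i hi, zero_mul]] at this
    exact lt_irrefl _ this
  let W := ∑ i, w i
  have hsum : ∑ i, w i / W = 1 := by rw [← Finset.sum_div, div_self hW.ne']
  -- By concavity this average satisfies `f x y ≥ φ (g x) / W > 0` for every `x ∈ s`, against `h`.
  let y : F := ∑ i, (w i / W) • (i.1 : F)
  have hyt : y ∈ t := (hconc x₀ hx₀).1.sum_mem (fun i _ => div_nonneg (hw i) hW.le) hsum
    fun i _ => i.1.2
  obtain ⟨x, hx, hxy⟩ := h y hyt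
  have := (hconc x hx).le_map_sum (t := Finset.univ) (w := fun i => w i / W)
    (p := fun i : u => (i.1 : F)) (fun i _ => div_nonneg (hw i) hW.le) hsum fun i _ => i.1.2
  have h5 : ∑ i, (w i / W) • f x i.1 = φ (g x) / W := by
    rw [hφ, Finset.sum_div]
    exact Finset.sum_congr rfl fun i _ => by simp only [smul_eq_mul, g]; ring
  rw [h5] at this
  exact absurd (this.trans hxy) (not_le.2 (div_pos (hpos x hx) hW))

end Minimax

/-! ### Trace inequalities and the noncommutative minimum -/

section MatrixLemmas

variable {d : Type*} [Fintype d]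

lemma trace_mul_re_nonneg {A B : Matrix d d ℂ} (hA : A.PosSemidef) (hB : B.PosSemidef) :
    0 ≤ (A * B).trace.re := by
  classical
  obtain ⟨C, rfl⟩ := (by
    open scoped MatrixOrder in
    exact CStarAlgebra.nonneg_iff_eq_star_mul_self.1 hA.nonneg : ∃ C, A = star C * C)
  rw [mul_assoc, trace_mul_comm, mul_assoc, ← mul_assoc]
  exact (Complex.le_def.1 (hB.mul_mul_conjTranspose_same C).trace_nonneg).1

lemma isClosed_posSemidef : IsClosed {A : Matrix d d ℂ | A.PosSemidef} := by
  have : {A : Matrix d d ℂ | A.PosSemidef} =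
      {A | Aᴴ = A} ∩ ⋂ v : d → ℂ, {A | 0 ≤ star v ⬝ᵥ (A *ᵥ v)} := by
    ext A
    simp [posSemidef_iff_dotProduct_mulVec, IsHermitian]
  rw [this]
  refine (isClosed_eq (by fun_prop) (by fun_prop)).inter (isClosed_iInter fun v => ?_)
  refine isClosed_le continuous_const ?_
  fun_prop

lemma ofReal_smul_one_posSemidef {d : Type*} [DecidableEq d] {r : ℝ} (hr : 0 ≤ r) :
    ((r : ℂ) • (1 : Matrix d d ℂ)).PosSemidef :=
  PosSemidef.one.smul (Complex.zero_le_real.2 hr)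

/-- The diagonal entries lie in `[0, r]`, and nonnegativity of the 2×2 principal minor bounds `‖A i
j‖ ^ 2` by their product. This gives the boundedness behind `isCompact_subtests`. -/
lemma norm_apply_le_of_posSemidef {d : Type*} [DecidableEq d] {A : Matrix d d ℂ} {r : ℝ} (hA : A.PosSemidef)
    (hr : ((r : ℂ) • (1 : Matrix d d ℂ) - A).PosSemidef) (i j : d) : ‖A i j‖ ≤ r := by
  have h1 : ∀ k, 0 ≤ (A k k).re ∧ (A k k).re ≤ r ∧ (A k k).im = 0 := by
    intro k
    have h2 := Complex.le_def.1 (hA.diag_nonneg (i := k))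
    have h3 := Complex.le_def.1 (hr.diag_nonneg (i := k))
    simp at h2 h3
    exact ⟨h2.1, h3.1, h2.2.symm⟩
  have h4 := (hA.submatrix ![i, j]).det_nonneg
  rw [det_fin_two] at h4
  simp only [submatrix_apply, cons_val_zero, cons_val_one] at h4
  have hij : A j i = star (A i j) := (hA.isHermitian.apply j i).symm
  have h5 : A i j * star (A i j) = ((‖A i j‖ ^ 2 : ℝ) : ℂ) := by
    rw [Complex.star_def, Complex.mul_conj, Complex.normSq_eq_norm_sq]
  rw [hij, h5] at h4
  have h6 := (Complex.le_def.1 h4).1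
  obtain ⟨a1, a2, a3⟩ := h1 i
  obtain ⟨b1, b2, b3⟩ := h1 j
  simp only [Complex.zero_re, Complex.sub_re, Complex.mul_re, a3, b3, Complex.ofReal_re] at h6
  have h7 : (A i i).re * (A j j).re ≤ r * r := mul_le_mul a2 b2 b1 (a1.trans a2)
  exact abs_le_of_sq_le_sq' (by nlinarith) (a1.trans a2) |>.2

variable [DecidableEq d]

lemma cfc_fun_id {A : Matrix d d ℂ} (hA : A.IsHermitian) : cfc (fun t : ℝ => t) A = A :=
  cfc_id' ℝ A hA.isSelfAdjoint

open scoped MatrixOrder in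
lemma posSemidef_cfc {f : ℝ → ℝ} (hf : ∀ t, 0 ≤ f t) (A : Matrix d d ℂ) :
    (cfc f A).PosSemidef :=
  nonneg_iff_posSemidef.1 (cfc_nonneg fun t _ => hf t)

/-- The spectrum is finite, so even the indicator function defining a spectral projection is
admissible in the functional calculus. -/
lemma continuousOn_spectrum (f : ℝ → ℝ) (A : Matrix d d ℂ) : ContinuousOn f (spectrum ℝ A) :=
  (Matrix.finite_real_spectrum (A := A)).continuousOn f

/-- With `A = V - B`, the matrix `V - V ∧ B` equals `(A + |A|) / 2`, the positive part of `A`. -/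
lemma trace_sub_ncMin_re (V B : Matrix d d ℂ) (hA : (V - B).IsHermitian) :
    V.trace.re - (ncMin V B).trace.re = (cfc (fun t : ℝ => max t 0) (V - B)).trace.re := by
  have h : cfc (fun t : ℝ => max t 0) (V - B) = V - ncMin V B := by
    have h1 : cfc (fun t : ℝ => max t 0) (V - B) =
        (1 / 2 : ℝ) • (V - B + cfc (fun t : ℝ => |t|) (V - B)) := by
      conv_rhs => enter [2, 1]; rw [← cfc_fun_id hA]
      rw [← cfc_add _ _ _ (continuousOn_spectrum _ _) (continuousOn_spectrum _ _),
        ← cfc_smul _ _ _ (continuousOn_spectrum _ _)]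
      congr 1
      ext t
      simp only [smul_eq_mul]
      rcases le_total t 0 with h | h
      · rw [max_eq_right h, abs_of_nonpos h]; ring
      · rw [max_eq_left h, abs_of_nonneg h]; ring
    rw [h1, ncMin]
    ext i j
    simp [Complex.real_smul]
    ring
  rw [h, trace_sub, Complex.sub_re]

/-- Weak duality for the noncommutative minimum. -/
lemma trace_mul_re_le {V B T : Matrix d d ℂ} {r : ℝ} (hA : (V - B).IsHermitian)
    (hT : T.PosSemidef) (hT' : ((r : ℂ) • 1 - T).PosSemidef) :
    ((V - B) * T).trace.re ≤ r * (V.trace.re - (ncMin V B).trace.re) := by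
  rw [trace_sub_ncMin_re V B hA]
  set A := V - B
  -- Jordan decomposition: pair the positive part with `r - T` and the negative part with `T`.
  have h1 : A = cfc (fun t : ℝ => max t 0) A - cfc (fun t : ℝ => max (-t) 0) A := by
    conv_lhs => rw [← cfc_fun_id hA]
    rw [← cfc_sub _ _ _ (continuousOn_spectrum _ _) (continuousOn_spectrum _ _)]
    congr 1
    ext t
    rcases le_total t 0 with h | h <;> simp [h]
  have h2 := trace_mul_re_nonneg (posSemidef_cfc (fun t => le_max_right t 0) A) hT'
  have h3 := trace_mul_re_nonneg (posSemidef_cfc (fun t => le_max_right (-t) 0) A) hT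
  have h4 := congrArg (fun Z => (Z * T).trace.re) h1
  simp only [sub_mul, mul_sub, trace_sub, Complex.sub_re, mul_smul_comm, mul_one, trace_smul,
    smul_eq_mul, Complex.re_ofReal_mul] at h2 h4
  linarith

/-- The noncommutative minimum is attained at the spectral projection of `V - B`. -/
lemma exists_trace_mul_re_eq {V B : Matrix d d ℂ} (hA : (V - B).IsHermitian) :
    ∃ P : Matrix d d ℂ, P.PosSemidef ∧ (1 - P).PosSemidef ∧
      ((V - B) * P).trace.re = V.trace.re - (ncMin V B).trace.re := by
  rw [trace_sub_ncMin_re V B hA]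
  set A := V - B
  refine ⟨cfc (fun t : ℝ => if 0 < t then 1 else 0) A, posSemidef_cfc (fun t => ?_) A, ?_, ?_⟩
  · split_ifs <;> norm_num
  · open scoped MatrixOrder in
    exact cfc_le_one (fun t : ℝ => if 0 < t then 1 else 0) A fun t _ => by split_ifs <;> norm_num
  · congr 2
    conv_lhs => enter [1]; rw [← cfc_fun_id hA]
    rw [← cfc_mul _ _ _ (continuousOn_spectrum _ _) (continuousOn_spectrum _ _)]
    congr 1
    ext t
    rcases le_or_gt t 0 with h | h
    · simp [h, not_lt.2 h]
    · simp [h, h.le]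

end MatrixLemmas

/-! ### Semidefinite duality for a cone of constraints -/

section Duality

variable {X d : Type*} [Fintype d]

lemma trace_mul_combo_re (B T T' : Matrix d d ℂ) (a b : ℝ) :
    (B * (a • T + b • T')).trace.re = a * (B * T).trace.re + b * (B * T').trace.re := by
  simp [mul_add, trace_add, trace_smul]

lemma trace_combo_mul_re (B B' T : Matrix d d ℂ) (a b : ℝ) :
    ((a • B + b • B') * T).trace.re = a * (B * T).trace.re + b * (B' * T).trace.re := by
  simp [add_mul, trace_add, trace_smul]

/-- The families `T` of operators with `0 ≼ T x ≼ p x`. -/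
def subtests [DecidableEq d] (p : X → ℝ) : Set (X → Matrix d d ℂ) :=
  {T | ∀ x, (T x).PosSemidef ∧ ((p x : ℂ) • 1 - T x).PosSemidef}

lemma isCompact_subtests [DecidableEq d] (p : X → ℝ) :
    IsCompact (subtests p : Set (X → Matrix d d ℂ)) := by
  have hK : IsCompact (Set.univ.pi fun x => Set.univ.pi fun _ => Set.univ.pi fun _ =>
      Metric.closedBall (0 : ℂ) (p x) : Set (X → d → d → ℂ)) :=
    isCompact_univ_pi fun x => isCompact_univ_pi fun _ => isCompact_univ_pi fun _ =>
      isCompact_closedBall _ _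
  refine hK.of_isClosed_subset ?_ fun T hT x _ i _ j _ => ?_
  · have : (subtests p : Set (X → Matrix d d ℂ)) =
        ⋂ x, {T | (T x).PosSemidef} ∩ {T | ((p x : ℂ) • 1 - T x).PosSemidef} := by
      ext T
      simp [subtests]
    change IsClosed (subtests p : Set (X → Matrix d d ℂ))
    rw [this]
    exact isClosed_iInter fun x =>
      (isClosed_posSemidef.preimage (f := fun T : X → Matrix d d ℂ => T x) (by fun_prop)).inter
      (isClosed_posSemidef.preimage
        (f := fun T : X → Matrix d d ℂ => (p x : ℂ) • 1 - T x) (by fun_prop))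
  · rw [mem_closedBall_zero_iff]
    exact norm_apply_le_of_posSemidef (hT x).1 (hT x).2 i j

lemma convex_posSemidef {d : Type*} : Convex ℝ {A : Matrix d d ℂ | A.PosSemidef} := by
  intro A hA B hB a b ha hb _
  exact (PosSemidef.smul hA ha).add (PosSemidef.smul hB hb)

lemma convex_subtests {X d : Type*} [DecidableEq d] (p : X → ℝ) :
    Convex ℝ (subtests p : Set (X → Matrix d d ℂ)) := by
  intro T hT T' hT' a b ha hb hab x
  refine ⟨convex_posSemidef (hT x).1 (hT' x).1 ha hb hab, ?_⟩
  have h := convex_posSemidef (hT x).2 (hT' x).2 ha hb hab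
  have h1 : (a : ℂ) + b = 1 := by exact_mod_cast hab
  have h2 : (p x : ℂ) • 1 - (a • T + b • T') x =
      a • ((p x : ℂ) • 1 - T x) + b • ((p x : ℂ) • 1 - T' x) := by
    ext i j
    simp only [Pi.add_apply, Pi.smul_apply, Matrix.add_apply, Matrix.sub_apply, Matrix.smul_apply, Complex.real_smul,
      smul_eq_mul]
    linear_combination (-(p x : ℂ) * (1 : Matrix d d ℂ) i j) * h1
  rw [h2]
  exact h

variable [Fintype X]

/-- The success weight `∑ x, Tr[W_x T_x]`. -/
def success (W : CQChannel X d) (T : X → Matrix d d ℂ) : ℝ :=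
  ∑ x, (W.state x * T x).trace.re

/-- The success probabilities of the families `0 ≼ T x ≼ p x` for which `M ∑ x, T x - 1` pairs
nonpositively with `C`. -/
def successValues [DecidableEq d] (C : Set (Matrix d d ℂ)) (M : ℕ) (W : CQChannel X d) : Set ℝ :=
  {s | ∃ p ∈ stdSimplex ℝ X, ∃ T ∈ subtests p,
    (∀ B ∈ C, (B * ((M : ℂ) • ∑ x, T x - 1)).trace.re ≤ 0) ∧ s = success W T}

lemma continuous_success (W : CQChannel X d) : Continuous (success W) := by
  unfold success
  have (x : X) : Continuous fun T : X → Matrix d d ℂ => (W.state x * T x).trace := by fun_prop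
  exact continuous_finsetSum _ fun x _ => Complex.continuous_re.comp (this x)

lemma success_combo (W : CQChannel X d) (T T' : X → Matrix d d ℂ) (a b : ℝ) :
    success W (a • T + b • T') = a * success W T + b * success W T' := by
  simp only [success, Pi.add_apply, Pi.smul_apply, trace_mul_combo_re, Finset.sum_add_distrib,
    Finset.mul_sum]

lemma success_nonneg [DecidableEq d] (W : CQChannel X d) {p : X → ℝ} {T : X → Matrix d d ℂ}
    (hT : T ∈ subtests p) : 0 ≤ success W T :=
  Finset.sum_nonneg fun x _ => trace_mul_re_nonneg (W.state_mem x).1 (hT x).1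

lemma success_le_one [DecidableEq d] (W : CQChannel X d) {p : X → ℝ} (hp : p ∈ stdSimplex ℝ X)
    {T : X → Matrix d d ℂ} (hT : T ∈ subtests p) : success W T ≤ 1 := by
  rw [← hp.2]
  refine Finset.sum_le_sum fun x _ => ?_
  have := trace_mul_re_nonneg (W.state_mem x).1 (hT x).2
  simp only [mul_sub, trace_sub, Complex.sub_re, mul_smul_comm, mul_one, trace_smul,
    smul_eq_mul, (W.state_mem x).2, Complex.ofReal_re] at this
  linarith

variable [DecidableEq d]

lemma trace_mul_constraint_re (B : Matrix d d ℂ) (M : ℕ) (T : X → Matrix d d ℂ) :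
    (B * ((M : ℂ) • ∑ x, T x - 1)).trace.re =
      M * ∑ x, (B * T x).trace.re - B.trace.re := by
  simp [mul_sub, trace_sub, Finset.mul_sum, trace_sum]

lemma bddAbove_successValues (C : Set (Matrix d d ℂ)) (M : ℕ) (W : CQChannel X d) :
    BddAbove (successValues C M W) := by
  refine ⟨1, ?_⟩
  rintro _ ⟨p, hp, T, hT, -, rfl⟩
  exact success_le_one W hp hT

lemma smul_one_mem_subtests {X d : Type*} [DecidableEq d] {p : X → ℝ} (hp : ∀ x, 0 ≤ p x) {r : ℝ} (hr : 0 ≤ r) (hr1 : r ≤ 1) :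
    (fun x => ((p x * r : ℝ) : ℂ) • (1 : Matrix d d ℂ)) ∈ subtests p := by
  refine fun x => ⟨ofReal_smul_one_posSemidef (mul_nonneg (hp x) hr), ?_⟩
  rw [← sub_smul, ← Complex.ofReal_sub]
  refine ofReal_smul_one_posSemidef ?_
  nlinarith [hp x]

/-- The family `T x = (p x / M) • 1`, for a point mass `p`, makes `M ∑ T x - 1` vanish, so it is
feasible whatever `C` is. -/
lemma successValues_nonempty [Nonempty X] (C : Set (Matrix d d ℂ)) {M : ℕ} (hM : 1 ≤ M)
    (W : CQChannel X d) : (successValues C M W).Nonempty := by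
  classical
  obtain ⟨x₀⟩ := ‹Nonempty X›
  have hp := single_mem_stdSimplex ℝ x₀
  have hM0 : (0 : ℝ) < M := by exact_mod_cast hM
  refine ⟨_, _, hp, _, smul_one_mem_subtests (r := (M : ℝ)⁻¹) hp.1 (by positivity)
    (inv_le_one_of_one_le₀ (by exact_mod_cast hM)), fun B _ => le_of_eq ?_, rfl⟩
  have : (M : ℂ) • ∑ x, (((Pi.single x₀ 1 : X → ℝ) x * (M : ℝ)⁻¹ : ℝ) : ℂ) •
      (1 : Matrix d d ℂ) - 1 = 0 := by
    rw [← Finset.sum_smul, ← Complex.ofReal_sum, ← Finset.sum_mul, hp.2, smul_smul]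
    have : (M : ℂ) ≠ 0 := by exact_mod_cast hM0.ne'
    simp [this]
  rw [this]
  simp

/-- Weak duality. -/
lemma success_add_dualObjective_le {C : Set (Matrix d d ℂ)} (hC : ∀ B ∈ C, B.IsHermitian)
    (M : ℕ) (W : CQChannel X d) {p : X → ℝ} (hp : p ∈ stdSimplex ℝ X) {T : X → Matrix d d ℂ}
    (hT : T ∈ subtests p) (hTC : ∀ B ∈ C, (B * ((M : ℂ) • ∑ x, T x - 1)).trace.re ≤ 0)
    {B : Matrix d d ℂ} (hB : B ∈ C) : success W T + dualObjective M W p B ≤ 1 := by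
  have h1 : ∀ x, (W.state x * T x).trace.re - M * (B * T x).trace.re +
      p x * (ncMin (W.state x) ((M : ℂ) • B)).trace.re ≤ p x := by
    intro x
    have hherm : (W.state x - (M : ℂ) • B).IsHermitian := by
      refine (W.state_mem x).1.isHermitian.sub ?_
      simp [IsHermitian, conjTranspose_smul, (hC B hB).eq]
    -- The bound is used with `r = p x`; summing over `x` recovers the dual objective.
    have := trace_mul_re_le hherm (hT x).1 (hT x).2
    rw [(W.state_mem x).2] at this
    simp only [sub_mul, trace_sub, Complex.sub_re, smul_mul_assoc, trace_smul, smul_eq_mul,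
      Complex.one_re, Complex.mul_re, Complex.natCast_re, Complex.natCast_im, zero_mul,
      sub_zero] at this
    linarith
  have h2 := Finset.sum_le_sum fun x (_ : x ∈ Finset.univ) => h1 x
  rw [hp.2, Finset.sum_add_distrib, Finset.sum_sub_distrib, ← Finset.mul_sum] at h2
  have h3 := hTC B hB
  rw [trace_mul_constraint_re] at h3
  rw [success, dualObjective]
  linarith

/-- The best family for a fixed dual variable. -/
lemma exists_subtests_eq {M : ℕ} (W : CQChannel X d) {p : X → ℝ} (hp : p ∈ stdSimplex ℝ X)
    {B : Matrix d d ℂ} (hB : B.IsHermitian) : ∃ T ∈ subtests p,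
      success W T - (B * ((M : ℂ) • ∑ x, T x - 1)).trace.re = 1 - dualObjective M W p B := by
  have hherm (x : X) : (W.state x - (M : ℂ) • B).IsHermitian := by
    refine (W.state_mem x).1.isHermitian.sub ?_
    simp [IsHermitian, conjTranspose_smul, hB.eq]
  choose P hP hP' hPe using fun x => exists_trace_mul_re_eq (hherm x)
  refine ⟨fun x => (p x : ℂ) • P x, fun x => ⟨?_, ?_⟩, ?_⟩
  · exact (hP x).smul (Complex.zero_le_real.2 (hp.1 x))
  · rw [← smul_sub]
    exact (hP' x).smul (Complex.zero_le_real.2 (hp.1 x))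
  · have h1 : ∀ x, (W.state x * ((p x : ℂ) • P x)).trace.re -
        M * (B * ((p x : ℂ) • P x)).trace.re =
        p x - p x * (ncMin (W.state x) ((M : ℂ) • B)).trace.re := by
      intro x
      have := hPe x
      rw [(W.state_mem x).2] at this
      simp only [sub_mul, trace_sub, Complex.sub_re, smul_mul_assoc, trace_smul, smul_eq_mul,
        Complex.one_re, Complex.mul_re, Complex.natCast_re, Complex.natCast_im, zero_mul,
        sub_zero] at this
      simp only [mul_smul_comm, trace_smul, smul_eq_mul, Complex.re_ofReal_mul]
      linear_combination p x * this
    have h2 := Finset.sum_congr rfl fun x (_ : x ∈ Finset.univ) => h1 x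
    rw [Finset.sum_sub_distrib, Finset.sum_sub_distrib, hp.2, ← Finset.mul_sum] at h2
    rw [trace_mul_constraint_re, success, dualObjective]
    linarith

/-- Strong duality for a fixed input distribution. -/
lemma exists_success_ge {C : Set (Matrix d d ℂ)} (hC : ∀ B ∈ C, B.IsHermitian) (hC0 : 0 ∈ C)
    (hCc : Convex ℝ C) (hCs : ∀ B ∈ C, ∀ r : ℝ, 0 ≤ r → r • B ∈ C)
    (M : ℕ) (W : CQChannel X d) {p : X → ℝ} (hp : p ∈ stdSimplex ℝ X) {c : ℝ}
    (hc : ∀ B ∈ C, dualObjective M W p B ≤ 1 - c) :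
    ∃ T ∈ subtests p, (∀ B ∈ C, (B * ((M : ℂ) • ∑ x, T x - 1)).trace.re ≤ 0) ∧
      c ≤ success W T := by
  -- Minimax for the Lagrangian, with `B` as multiplier; for each single `B` the spectral-projection
  -- family is a response.
  obtain ⟨T, hT, h⟩ := exists_forall_nonpos_of_forall_exists (isCompact_subtests p)
    (convex_subtests p) ⟨0, hC0⟩
    (fun T B => c - success W T + (B * ((M : ℂ) • ∑ x, T x - 1)).trace.re)
    (fun B _ => by
      have : Continuous fun T : X → Matrix d d ℂ => (B * ((M : ℂ) • ∑ x, T x - 1)).trace := by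
        fun_prop
      exact (continuous_const.sub (continuous_success W)).add (Complex.continuous_re.comp this))
    (fun B _ T T' a b _ _ hab => by
      rw [trace_mul_constraint_re, trace_mul_constraint_re, trace_mul_constraint_re]
      simp only [success_combo, Pi.add_apply, Pi.smul_apply,
        trace_mul_combo_re, Finset.sum_add_distrib, ← Finset.mul_sum]
      linear_combination (-c + B.trace.re) * hab)
    (fun T _ => ⟨hCc, fun B _ B' _ a b _ _ hab => by
      simp only [trace_combo_mul_re, smul_eq_mul]
      exact le_of_eq (by linear_combination (c - success W T) * hab)⟩)
    (fun B hB => by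
      obtain ⟨T, hT, h⟩ := exists_subtests_eq (M := M) W hp (hC B hB)
      exact ⟨T, hT, by linarith [hc B hB]⟩)
  refine ⟨T, hT, fun B hB => ?_, ?_⟩
  · by_contra! hpos
    set g := (B * ((M : ℂ) • ∑ x, T x - 1)).trace.re with hg
    -- A violated constraint is amplified along the cone until its term is `|c - success W T| + 1`,
    -- which outweighs `c - success W T`.
    have h1 := h _ (hCs B hB ((|c - success W T| + 1) / g) (by positivity))
    simp only [smul_mul_assoc, trace_smul, Complex.smul_re, smul_eq_mul, ← hg] at h1
    rw [div_mul_cancel₀ _ hpos.ne'] at h1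
    linarith [neg_abs_le (c - success W T)]
  · have := h 0 hC0
    simp at this
    linarith

theorem one_sub_sSup_successValues [Nonempty X] {C : Set (Matrix d d ℂ)}
    (hC : ∀ B ∈ C, B.IsHermitian) (hC0 : 0 ∈ C)
    (hCc : Convex ℝ C) (hCs : ∀ B ∈ C, ∀ r : ℝ, 0 ≤ r → r • B ∈ C)
    {M : ℕ} (hM : 1 ≤ M) (W : CQChannel X d) :
    ((1 - sSup (successValues C M W) : ℝ) : EReal) =
      ⨅ p : stdSimplex ℝ X, ⨆ B : C, ((dualObjective M W p B : ℝ) : EReal) := by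
  refine le_antisymm (le_iInf fun p => ?_) ?_
  · by_contra! hlt
    obtain ⟨r, hr, hr'⟩ := EReal.lt_iff_exists_real_btwn.1 hlt
    obtain ⟨T, hT, hTC, hs⟩ := exists_success_ge hC hC0 hCc hCs M W p.2 (c := 1 - r)
      fun B hB => by
        have := (le_iSup (fun B : C => ((dualObjective M W p B : ℝ) : EReal)) ⟨B, hB⟩).trans hr.le
        rw [EReal.coe_le_coe_iff] at this
        rw [sub_sub_cancel]
        exact this
    have h1 := le_csSup (bddAbove_successValues C M W) ⟨p, p.2, T, hT, hTC, rfl⟩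
    rw [EReal.coe_lt_coe_iff] at hr'
    linarith
  · refine EReal.le_of_forall_lt_iff_le.1 fun z hz => ?_
    rw [EReal.coe_lt_coe_iff] at hz
    obtain ⟨_, ⟨p, hp, T, hT, hTC, rfl⟩, hs⟩ :=
      exists_lt_of_lt_csSup (successValues_nonempty C hM W)
        (show 1 - z < sSup (successValues C M W) by linarith)
    refine (iInf_le _ ⟨p, hp⟩).trans (iSup_le fun B => ?_)
    rw [EReal.coe_le_coe_iff]
    have := success_add_dualObjective_le hC M W hp hT hTC B.2
    change dualObjective M W p B ≤ z
    linarith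

end Duality

/-! ### The two cones and the constraints they encode -/

section Constraints

variable {X d : Type*} [Fintype X] [Fintype d] [DecidableEq d]

/-- Testing against `Dᴴ` makes the Hilbert–Schmidt norm of `D` vanish. -/
lemma eq_zero_of_forall_isHermitian {d : Type*} [Fintype d] {D : Matrix d d ℂ} (hD : D.IsHermitian)
    (h : ∀ B : Matrix d d ℂ, B.IsHermitian → (B * D).trace.re ≤ 0) : D = 0 := by
  rw [← trace_conjTranspose_mul_self_eq_zero_iff]
  have h1 := Complex.le_def.1 (posSemidef_conjTranspose_mul_self D).trace_nonneg
  have h2 := h Dᴴ hD.conjTranspose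
  exact Complex.ext (le_antisymm h2 h1.1) h1.2.symm

/-- Rank-one tests suffice: pairing with the projector direction `v v*` yields the quadratic form of
`D` at `v`. -/
lemma neg_posSemidef_of_forall_posSemidef {d : Type*} [Fintype d] {D : Matrix d d ℂ} (hD : D.IsHermitian)
    (h : ∀ B : Matrix d d ℂ, B.PosSemidef → (B * D).trace.re ≤ 0) : (-D).PosSemidef := by
  rw [posSemidef_iff_dotProduct_mulVec]
  refine ⟨hD.neg, fun v => ?_⟩
  have h1 := h _ (posSemidef_vecMulVec_self_star v)
  rw [vecMulVec_mul, trace_vecMulVec, dotProduct_comm, ← dotProduct_mulVec] at h1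
  have h2 := hD.neg.im_star_dotProduct_mulVec_self v
  refine Complex.le_def.2 ⟨?_, ?_⟩
  · simpa [neg_mulVec] using h1
  · exact h2.symm

lemma isHermitian_constraint {X d : Type*} [Fintype X] [DecidableEq d] {p : X → ℝ} {T : X → Matrix d d ℂ} (hT : T ∈ subtests p) (M : ℕ) :
    ((M : ℂ) • ∑ x, T x - 1).IsHermitian := by
  have h : (∑ x, T x).IsHermitian := (posSemidef_sum _ fun x _ => (hT x).1).isHermitian
  simp [IsHermitian, conjTranspose_smul, h.eq]

lemma mem_successValues_isHermitian {M : ℕ} {W : CQChannel X d} {s : ℝ} :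
    s ∈ successValues {B | B.IsHermitian} M W ↔ ∃ p ∈ stdSimplex ℝ X, ∃ T ∈ subtests p,
      (M : ℂ) • ∑ x, T x = 1 ∧ s = success W T := by
  refine exists_congr fun p => and_congr_right fun _ => exists_congr fun T =>
    and_congr_right fun hT => and_congr_left fun _ => ⟨fun h => ?_, fun h B _ => ?_⟩
  · exact sub_eq_zero.1 (eq_zero_of_forall_isHermitian (isHermitian_constraint hT M) h)
  · simp [h]

lemma mem_successValues_posSemidef {M : ℕ} {W : CQChannel X d} {s : ℝ} :
    s ∈ successValues {B | B.PosSemidef} M W ↔ ∃ p ∈ stdSimplex ℝ X, ∃ T ∈ subtests p,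
      (1 - (M : ℂ) • ∑ x, T x).PosSemidef ∧ s = success W T := by
  refine exists_congr fun p => and_congr_right fun _ => exists_congr fun T =>
    and_congr_right fun hT => and_congr_left fun _ => ⟨fun h => ?_, fun h B hB => ?_⟩
  · rw [← neg_sub]
    exact neg_posSemidef_of_forall_posSemidef (isHermitian_constraint hT M) h
  · have := trace_mul_re_nonneg hB h
    rw [← neg_sub, mul_neg, trace_neg, Complex.neg_re] at this
    linarith

lemma nonempty_of_state {X d : Type*} [Fintype d] [Nonempty X] (W : CQChannel X d) :
    Nonempty d := by
  by_contra h
  rw [not_nonempty_iff] at h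
  have := (W.state_mem (Classical.arbitrary X)).2
  simp [trace] at this

end Constraints

/-! ### Non-signaling codes as feasible families -/

section NonSignalingValue

variable {X d : Type*} [Fintype d]

lemma posSemidef_blockDiagonal {Y : Type*} [Fintype Y] [DecidableEq Y] {A : Y → Matrix d d ℂ}
    (hA : ∀ y, (A y).PosSemidef) : (blockDiagonal A).PosSemidef := by
  classical
  choose C hC using fun y => (by
    open scoped MatrixOrder in
    exact CStarAlgebra.nonneg_iff_eq_star_mul_self.1 (hA y).nonneg : ∃ C, A y = star C * C)
  have : blockDiagonal A = (blockDiagonal C)ᴴ * blockDiagonal C := by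
    rw [blockDiagonal_conjTranspose, ← blockDiagonal_mul]
    exact congrArg _ (funext hC)
  rw [this]
  exact posSemidef_conjTranspose_mul_self _

variable [Fintype X] [DecidableEq X]

lemma toMap_single (W : CQChannel X d) (a a' : X) :
    W.toMap (single a a' 1) = if a = a' then W.state a else 0 := by
  change ∑ x, (single a a' (1 : ℂ)) x x • W.state x = _
  by_cases h : a = a'
  · subst h
    rw [Finset.sum_eq_single a (fun x _ hx => by simp [hx.symm]) (by simp)]
    simp
  · simp only [h, if_false]
    refine Finset.sum_eq_zero fun x _ => ?_
    rw [single_apply_of_ne, zero_smul]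
    rintro ⟨rfl, rfl⟩
    exact h rfl

/-- A classical-quantum channel ignores off-diagonal input, so only blocks of `J` diagonal in `A_i`
and `A_o` contribute. The transpose comes from the Choi convention. -/
lemma effectiveMap_single {M : ℕ}
    (J : Matrix (Fin M × X × d × Fin M) (Fin M × X × d × Fin M) ℂ) (W : CQChannel X d)
    (m : Fin M) : effectiveMap J W.toMap (single m m 1) m m =
      ∑ x, (W.state x * (J.submatrix (fun c => (m, x, c, m)) fun c => (m, x, c, m))ᵀ).trace := by
  simp only [effectiveMap, of_apply, toMap_single]
  rw [Finset.sum_eq_single m (fun i _ hi => ?_) (by simp),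
    Finset.sum_eq_single m (fun i _ hi => ?_) (by simp)]
  · refine Finset.sum_congr rfl fun x _ => ?_
    rw [Finset.sum_eq_single x (fun i _ hi => by simp [hi.symm]) (by simp)]
    simp [trace, mul_apply, mul_comm]
  · simp [hi.symm]
  · simp [hi.symm]

variable [DecidableEq d]

lemma success_mem_of_isNonSignaling [Nonempty X] {M : ℕ} (hM : 1 ≤ M) (W : CQChannel X d)
    {J : Matrix (Fin M × X × d × Fin M) (Fin M × X × d × Fin M) ℂ} (hJ : IsNonSignaling J) :
    (1 / (M : ℝ)) * ∑ m : Fin M, (effectiveMap J W.toMap (single m m 1) m m).re ∈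
      successValues {B | B.IsHermitian} M W := by
  obtain ⟨K, hK⟩ := hJ.notAliceToBob
  obtain ⟨L, hL⟩ := hJ.notBobToAlice
  obtain ⟨c₀⟩ := nonempty_of_state W
  have hM0 : (M : ℂ) ≠ 0 := by exact_mod_cast (by omega : M ≠ 0)
  -- Here `m` is the message, `b` the decoded message and `x` the channel input. Then `p` averages
  -- the weights of `x`, and `T` the correctly decoding blocks, over `m`.
  let G : Fin M → Fin M → X → Matrix d d ℂ := fun m b x =>
    (J.submatrix (fun c => (m, x, c, b)) fun c => (m, x, c, b))ᵀ
  have hG : ∀ m b x, (G m b x).PosSemidef := fun m b x => (hJ.posSemidef.submatrix _).transpose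
  have hGb : ∀ m x, ∑ b, G m b x = L (m, x) (m, x) • (1 : Matrix d d ℂ) := by
    intro m x
    ext i j
    have := congrFun₂ hL ((m, x), j) ((m, x), i)
    simp only [traceBo, of_apply, kroneckerMap_apply] at this
    simp only [Matrix.sum_apply, G, transpose_apply, submatrix_apply, this, Matrix.smul_apply,
      smul_eq_mul, one_apply, eq_comm]
  have hGx : ∀ m b, ∑ x, G m b x = of fun i j => K (j, b) (i, b) := by
    intro m b
    ext i j
    have := congrFun₂ hK (m, j, b) (m, i, b)
    simp only [traceAo, of_apply, kroneckerMap_apply, one_apply_eq, one_mul] at this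
    simp only [Matrix.sum_apply, G, transpose_apply, submatrix_apply, this, of_apply]
  have hG1 : ∀ m, ∑ x, ∑ b, G m b x = 1 := by
    intro m
    ext i j
    have := congrFun₂ hJ.tracePreserving (m, j) (m, i)
    simp only [traceAoBo, of_apply] at this
    simp only [Matrix.sum_apply, G, transpose_apply, submatrix_apply, this, one_apply, Prod.mk.injEq,
      true_and, eq_comm]
  have hL0 : ∀ m x, 0 ≤ L (m, x) (m, x) := by
    intro m x
    have h := (posSemidef_sum Finset.univ fun b _ => hG m b x).diag_nonneg (i := c₀)
    rw [hGb] at h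
    simpa using h
  have hL1 : ∀ m, ∑ x, L (m, x) (m, x) = 1 := by
    intro m
    have h := congrFun₂ (hG1 m) c₀ c₀
    simp only [hGb, Matrix.sum_apply, Matrix.smul_apply, one_apply_eq, smul_eq_mul, mul_one] at h
    exact h
  let p : X → ℝ := fun x => (M : ℝ)⁻¹ * ∑ m, (L (m, x) (m, x)).re
  have hpc : ∀ x, (p x : ℂ) = (M : ℂ)⁻¹ * ∑ m, L (m, x) (m, x) := by
    intro x
    simp only [p]
    push_cast
    congr 1
    exact Finset.sum_congr rfl fun m _ => Complex.ext rfl (Complex.le_def.1 (hL0 m x)).2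
  rw [mem_successValues_isHermitian]
  refine ⟨p, ⟨fun x => ?_, ?_⟩, fun x => (M : ℂ)⁻¹ • ∑ m, G m m x, fun x => ⟨?_, ?_⟩, ?_, ?_⟩
  · exact mul_nonneg (by positivity)
      (Finset.sum_nonneg fun m _ => (Complex.le_def.1 (hL0 m x)).1)
  · have : ((∑ x, p x : ℝ) : ℂ) = 1 := by
      push_cast
      simp only [hpc]
      rw [← Finset.mul_sum, Finset.sum_comm]
      simp [hL1, hM0]
    exact_mod_cast this
  · exact (posSemidef_sum _ fun m _ => hG m m x).smul (by positivity)
  -- What remains is the total of the wrongly decoding blocks `b ≠ m`.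
  · have : (p x : ℂ) • (1 : Matrix d d ℂ) - (M : ℂ)⁻¹ • ∑ m, G m m x =
        (M : ℂ)⁻¹ • ∑ m, ∑ b ∈ Finset.univ.erase m, G m b x := by
      rw [hpc, mul_smul, ← smul_sub, Finset.sum_smul, ← Finset.sum_sub_distrib]
      congr 1
      refine Finset.sum_congr rfl fun m _ => ?_
      rw [← hGb, ← Finset.add_sum_erase _ _ (Finset.mem_univ m), add_sub_cancel_left]
    rw [this]
    exact (posSemidef_sum _ fun m _ => posSemidef_sum _ fun b _ => hG m b x).smul (by positivity)
  -- Since Alice cannot signal, `∑ x, G m m x` equals `∑ x, G 0 m x`; the sum over `m` is then over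
  -- all outputs for one message, hence `1` by trace preservation.
  · rw [← Finset.smul_sum, smul_smul, mul_inv_cancel₀ hM0, one_smul, Finset.sum_comm,
      Finset.sum_congr rfl fun m _ => (hGx m m).trans (hGx ⟨0, hM⟩ m).symm, Finset.sum_comm, hG1]
  · have h : ∀ x, (W.state x * ((M : ℂ)⁻¹ • ∑ m, G m m x)).trace.re =
        (M : ℝ)⁻¹ * ∑ m, (W.state x * G m m x).trace.re := by
      intro x
      rw [mul_smul_comm, trace_smul, Matrix.mul_sum, trace_sum, smul_eq_mul,
        ← Complex.ofReal_natCast, ← Complex.ofReal_inv, Complex.re_ofReal_mul, Complex.re_sum]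
    simp only [success, effectiveMap_single, h, Complex.re_sum]
    rw [← Finset.mul_sum, Finset.sum_comm, one_div]

lemma exists_isNonSignaling {M : ℕ} (hM : 1 ≤ M) (W : CQChannel X d) {p : X → ℝ}
    (hp : p ∈ stdSimplex ℝ X) {T : X → Matrix d d ℂ} (hT : T ∈ subtests p)
    (hT1 : (M : ℂ) • ∑ x, T x = 1) :
    ∃ J : Matrix (Fin M × X × d × Fin M) (Fin M × X × d × Fin M) ℂ, IsNonSignaling J ∧
      success W T =
        (1 / (M : ℝ)) * ∑ m : Fin M, (effectiveMap J W.toMap (single m m 1) m m).re := by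
  have hM0 : (M : ℂ) ≠ 0 := by exact_mod_cast (by omega : M ≠ 0)
  have hM1 : (0 : ℝ) ≤ (M : ℝ) - 1 := sub_nonneg.2 (by exact_mod_cast hM)
  have hsum : ∑ x, T x = (M : ℂ)⁻¹ • (1 : Matrix d d ℂ) := by
    rw [← hT1, smul_smul, inv_mul_cancel₀ hM0, one_smul]
  have hpsum : ∑ x, (p x : ℂ) = 1 := by exact_mod_cast hp.2
  -- Each wrong output receives an equal share of `p x - T x`. For `M = 1` this is `0`, harmlessly:
  -- there are no wrong outputs.
  let r : ℂ := (((M : ℝ) - 1)⁻¹ : ℝ)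
  have hr : r = ((M : ℂ) - 1)⁻¹ := by simp [r]
  let G : Fin M → Fin M → X → Matrix d d ℂ := fun m b x =>
    if m = b then (T x)ᵀ else r • ((p x : ℂ) • 1 - T x)ᵀ
  have hG : ∀ m b x, (G m b x).PosSemidef := by
    intro m b x
    simp only [G]
    split_ifs
    · exact (hT x).1.transpose
    · exact (hT x).2.transpose.smul (Complex.zero_le_real.2 (inv_nonneg.2 hM1))
  have hGx : ∀ m b, ∑ x, G m b x = (M : ℂ)⁻¹ • (1 : Matrix d d ℂ) := by
    intro m b
    by_cases h : m = b
    · simp only [G, h, if_true]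
      rw [← transpose_sum, hsum]
      simp
    · have hM2 : (M : ℂ) - 1 ≠ 0 := by
        rw [sub_ne_zero]
        intro h1
        have : M = 1 := by exact_mod_cast h1
        subst this
        exact h (Subsingleton.elim _ _)
      simp only [G, h, if_false]
      rw [← Finset.smul_sum, ← transpose_sum, Finset.sum_sub_distrib, ← Finset.sum_smul, hpsum,
        hsum, ← sub_smul, transpose_smul, transpose_one, smul_smul, hr]
      congr 1
      field_simp
  have hGb : ∀ m x, ∑ b, G m b x = (p x : ℂ) • (1 : Matrix d d ℂ) := by
    intro m x
    rw [← Finset.add_sum_erase _ _ (Finset.mem_univ m)]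
    have h1 : ∑ b ∈ Finset.univ.erase m, G m b x =
        ∑ b ∈ Finset.univ.erase m, r • ((p x : ℂ) • 1 - T x)ᵀ :=
      Finset.sum_congr rfl fun b hb => if_neg (Finset.ne_of_mem_erase hb).symm
    rw [h1, Finset.sum_const, Finset.card_erase_of_mem (Finset.mem_univ m), Finset.card_univ,
      Fintype.card_fin]
    simp only [G, if_true]
    rcases hM.eq_or_lt with h | h
    -- For `M = 1` the constraint makes these positive semidefinite differences sum to zero, so each
    -- of them vanishes.
    · have h2 : ∑ x, ((p x : ℂ) • 1 - T x) = 0 := by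
        rw [Finset.sum_sub_distrib, ← Finset.sum_smul, hpsum, hsum, ← h]
        simp
      have h3 : (p x : ℂ) • 1 - T x = 0 := by
        open scoped MatrixOrder in
        exact (Finset.sum_eq_zero_iff_of_nonneg fun x _ => (hT x).2.nonneg).1 h2 x
          (Finset.mem_univ x)
      rw [← h, Nat.sub_self, zero_smul, add_zero, ← sub_eq_zero.1 h3]
      simp
    · have hM2 : (M : ℂ) - 1 ≠ 0 := by
        rw [sub_ne_zero]
        exact_mod_cast h.ne'
      rw [← Nat.cast_smul_eq_nsmul ℂ, smul_smul, Nat.cast_sub hM, hr, Nat.cast_one,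
        mul_inv_cancel₀ hM2, one_smul]
      simp
  let J : Matrix (Fin M × X × d × Fin M) (Fin M × X × d × Fin M) ℂ :=
    (blockDiagonal fun k : Fin M × X × Fin M => G k.1 k.2.2 k.2.1).submatrix
      (fun i => (i.2.2.1, (i.1, i.2.1, i.2.2.2))) fun i => (i.2.2.1, (i.1, i.2.1, i.2.2.2))
  have hJ : ∀ m x c b m' x' c' b', J (m, x, c, b) (m', x', c', b') =
      if m = m' ∧ x = x' ∧ b = b' then G m b x c c' else 0 := by
    intro m x c b m' x' c' b'
    simp [J, blockDiagonal_apply]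
  refine ⟨J, ⟨?_, ?_, ?_, ?_⟩, ?_⟩
  · exact (posSemidef_blockDiagonal fun k => hG _ _ _).submatrix _
  · ext ⟨m, c⟩ ⟨m', c'⟩
    simp only [traceAoBo, of_apply, hJ, and_true]
    by_cases h : m = m'
    · subst h
      simp only [if_true, ← Matrix.sum_apply, hGb]
      simp [Matrix.sum_apply, one_apply, hpsum]
    · simp [h, one_apply]
  · refine ⟨of fun u v => if u.2 = v.2 then (M : ℂ)⁻¹ * (1 : Matrix d d ℂ) u.1 v.1 else 0, ?_⟩
    ext ⟨m, c, b⟩ ⟨m', c', b'⟩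
    simp only [traceAo, of_apply, hJ, true_and, kroneckerMap_apply]
    by_cases h : m = m'
    · by_cases hb : b = b'
      · subst h hb
        simp only [and_self, if_true, ← Matrix.sum_apply, hGx]
        simp
      · simp [hb]
    · simp [h]
  · refine ⟨diagonal fun u => (p u.2 : ℂ), ?_⟩
    ext ⟨⟨m, x⟩, c⟩ ⟨⟨m', x'⟩, c'⟩
    simp only [traceBo, of_apply, hJ, and_true, kroneckerMap_apply]
    by_cases h : m = m' ∧ x = x'
    · obtain ⟨rfl, rfl⟩ := h
      simp only [and_self, if_true, ← Matrix.sum_apply, hGb]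
      simp
    · rw [diagonal_apply_ne _ (by simpa using h)]
      simp [h]
  · have h1 : ∀ m x, (J.submatrix (fun c => (m, x, c, m)) fun c => (m, x, c, m))ᵀ = T x := by
      intro m x
      ext i j
      simp [hJ, G]
    simp only [effectiveMap_single, h1, success, Complex.re_sum, Finset.sum_const,
      Finset.card_univ, Fintype.card_fin, nsmul_eq_mul]
    have : (M : ℝ) ≠ 0 := by exact_mod_cast hM0
    field_simp

theorem epsNS_eq [Nonempty X] {M : ℕ} (hM : 1 ≤ M) (W : CQChannel X d) :
    epsNS M W = 1 - sSup (successValues {B | B.IsHermitian} M W) := by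
  rw [epsNS]
  congr 2
  ext s
  constructor
  · rintro ⟨J, hJ, rfl⟩
    exact success_mem_of_isNonSignaling hM W hJ
  · rw [mem_successValues_isHermitian]
    rintro ⟨p, hp, T, hT, hT1, rfl⟩
    exact exists_isNonSignaling hM W hp hT hT1

end NonSignalingValue

/-! ### The perfect bit as a reservoir for slack -/

section BitChannel

variable {X d : Type*} [Fintype X] [Fintype d]

lemma trace_kronecker_single_mul {d e : Type*} [Fintype d] [Fintype e] [DecidableEq e] (A : Matrix d d ℂ)
    (B : Matrix (d × e) (d × e) ℂ) (i : e) : ((A ⊗ₖ single i i 1) * B).trace =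
      (A * B.submatrix (fun a => (a, i)) fun a => (a, i)).trace := by
  simp only [trace, diag_apply, mul_apply, Fintype.sum_prod_type, kroneckerMap_apply,
    submatrix_apply]
  refine Finset.sum_congr rfl fun a _ => ?_
  rw [Finset.sum_eq_single i (fun j _ hj => ?_) (by simp)]
  · refine Finset.sum_congr rfl fun b _ => ?_
    rw [Finset.sum_eq_single i (fun j _ hj => by simp [hj.symm]) (by simp)]
    simp
  · exact Finset.sum_eq_zero fun b _ => Finset.sum_eq_zero fun k _ => by simp [hj.symm]

lemma posSemidef_one_sub_single (i : Fin 2) :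
    (1 - single i i 1 : Matrix (Fin 2) (Fin 2) ℂ).PosSemidef := by
  have : (1 - single i i 1 : Matrix (Fin 2) (Fin 2) ℂ) = bitChannel.state (1 - i) := by
    ext j k
    fin_cases i <;> fin_cases j <;> fin_cases k <;> simp [bitChannel]
  rw [this]
  exact (bitChannel.state_mem _).1

lemma success_tensor_bitChannel (W : CQChannel X d)
    (T : X × Fin 2 → Matrix (d × Fin 2) (d × Fin 2) ℂ) :
    success (W.tensor bitChannel) T =
      success W fun x => ∑ i, (T (x, i)).submatrix (fun a => (a, i)) fun a => (a, i) := by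
  simp only [success, CQChannel.tensor, bitChannel, trace_kronecker_single_mul,
    Fintype.sum_prod_type, Matrix.mul_sum, trace_sum, Complex.re_sum]

variable [DecidableEq d]

lemma success_tensor_mem {M : ℕ} {W : CQChannel X d} {s : ℝ}
    (h : s ∈ successValues {B | B.IsHermitian} (2 * M) (W.tensor bitChannel)) :
    s ∈ successValues {B | B.PosSemidef} M W := by
  rw [mem_successValues_isHermitian] at h
  obtain ⟨p, hp, T, hT, hT1, rfl⟩ := h
  rw [mem_successValues_posSemidef]
  let S : Fin 2 → X × Fin 2 → Matrix d d ℂ := fun i z =>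
    (T z).submatrix (fun a => (a, i)) fun a => (a, i)
  have hS : ∀ i z, (S i z).PosSemidef := fun i z => (hT z).1.submatrix _
  have hS' : ∀ i z, ((p z : ℂ) • 1 - S i z).PosSemidef := by
    intro i z
    have h1 := (hT z).2.submatrix fun a => (a, i)
    have h2 : ((p z : ℂ) • 1 - T z).submatrix (fun a : d => (a, i)) (fun a => (a, i)) =
        (p z : ℂ) • 1 - S i z := by
      ext a b
      simp [S, one_apply]
    rwa [h2] at h1
  have hS1 : ∀ i, (2 * M : ℂ) • ∑ x, (S i (x, 0) + S i (x, 1)) = 1 := by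
    intro i
    have h1 := congrArg (fun Z => Z.submatrix (fun a : d => (a, i)) fun a => (a, i)) hT1
    ext a b
    have h2 := congrFun₂ h1 a b
    simpa [S, Matrix.sum_apply, Fintype.sum_prod_type, one_apply] using h2
  refine ⟨fun x => ∑ i, p (x, i), ⟨fun x => Finset.sum_nonneg fun i _ => hp.1 _, ?_⟩,
    fun x => ∑ i, S i (x, i), fun x => ⟨posSemidef_sum _ fun i _ => hS _ _, ?_⟩, ?_,
    success_tensor_bitChannel W T⟩
  · rw [← Fintype.sum_prod_type]
    exact hp.2
  · push_cast
    rw [Finset.sum_smul, ← Finset.sum_sub_distrib]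
    exact posSemidef_sum _ fun i _ => hS' _ _
  -- Averaging the two diagonal blocks of the equality constraint shows that the slack is carried by
  -- the mismatched blocks.
  · have h1 : (1 : Matrix d d ℂ) - (M : ℂ) • ∑ x, ∑ i, S i (x, i) =
        (M : ℂ) • ∑ x, (S 0 (x, 1) + S 1 (x, 0)) := by
      have h2 : (1 : Matrix d d ℂ) = (1 / 2 : ℂ) • (1 + 1) := by
        rw [← two_smul ℂ, smul_smul]; norm_num
      rw [h2]
      nth_rewrite 1 [← hS1 0]
      rw [← hS1 1]
      simp only [Fin.sum_univ_two, Finset.sum_add_distrib]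
      module
    rw [h1]
    exact (posSemidef_sum _ fun x _ => (hS _ _).add (hS _ _)).smul (by positivity)

lemma mem_success_tensor {M : ℕ} (hM : 1 ≤ M) {W : CQChannel X d} {s : ℝ}
    (h : s ∈ successValues {B | B.PosSemidef} M W) :
    s ∈ successValues {B | B.IsHermitian} (2 * M) (W.tensor bitChannel) := by
  rw [mem_successValues_posSemidef] at h
  obtain ⟨p, hp, T, hT, hT1, rfl⟩ := h
  rw [mem_successValues_isHermitian]
  have hM0 : (M : ℂ) ≠ 0 := by exact_mod_cast (by omega : M ≠ 0)
  let E : Fin 2 → Matrix (Fin 2) (Fin 2) ℂ := fun i => single i i 1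
  have hE : ∀ i, (E i).PosSemidef := fun i => (bitChannel.state_mem i).1
  have hE' : ∀ i, (1 - E i).PosSemidef := posSemidef_one_sub_single
  have hEsum : ∑ i, E i = 1 := sum_single_one
  -- `R` is the unused part of the constraint. The bit is chosen uniformly, and the mismatched
  -- blocks receive `p x • R`, so both diagonal blocks sum to the required multiple of `1`.
  let R : Matrix d d ℂ := (M : ℂ)⁻¹ • 1 - ∑ x, T x
  have hR : R.PosSemidef := by
    have : R = (M : ℂ)⁻¹ • (1 - (M : ℂ) • ∑ x, T x) := by
      rw [smul_sub, smul_smul, inv_mul_cancel₀ hM0, one_smul]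
    rw [this]
    exact hT1.smul (by positivity)
  have hR' : (1 - R).PosSemidef := by
    have : 1 - R = ((1 - (M : ℝ)⁻¹ : ℝ) : ℂ) • 1 + ∑ x, T x := by
      simp only [R]
      push_cast
      module
    rw [this]
    exact (ofReal_smul_one_posSemidef (sub_nonneg.2 (inv_le_one_of_one_le₀
      (by exact_mod_cast hM)))).add (posSemidef_sum _ fun x _ => (hT x).1)
  have hpc : ∀ x, 0 ≤ (p x : ℂ) := fun x => Complex.zero_le_real.2 (hp.1 x)
  have hpsum : ∑ x, (p x : ℂ) = 1 := by exact_mod_cast hp.2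
  have h2 : (0 : ℂ) ≤ 1 / 2 := by positivity
  refine ⟨fun z => p z.1 / 2, ⟨fun z => div_nonneg (hp.1 _) zero_le_two, ?_⟩,
    fun z => (1 / 2 : ℂ) • (T z.1 ⊗ₖ E z.2 + ((p z.1 : ℂ) • R) ⊗ₖ (1 - E z.2)),
    fun z => ⟨?_, ?_⟩, ?_, ?_⟩
  · rw [Fintype.sum_prod_type]
    simp [mul_div_cancel₀, hp.2]
  · exact (((hT _).1.kronecker (hE _)).add ((hR.smul (hpc _)).kronecker (hE' _))).smul h2
  · have h3 := ((((hT z.1).2.kronecker (hE z.2)).add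
      ((hR'.smul (hpc z.1)).kronecker (hE' z.2)))).smul h2
    have h4 : ((p z.1 / 2 : ℝ) : ℂ) • (1 : Matrix (d × Fin 2) (d × Fin 2) ℂ) -
        (1 / 2 : ℂ) • (T z.1 ⊗ₖ E z.2 + ((p z.1 : ℂ) • R) ⊗ₖ (1 - E z.2)) =
        (1 / 2 : ℂ) • (((p z.1 : ℂ) • 1 - T z.1) ⊗ₖ E z.2 +
          ((p z.1 : ℂ) • (1 - R)) ⊗ₖ (1 - E z.2)) := by
      rw [← one_kronecker_one]
      ext a b
      simp only [Matrix.add_apply, Matrix.sub_apply, Matrix.smul_apply, kroneckerMap_apply,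
        smul_eq_mul]
      push_cast
      ring
    rw [h4]
    exact h3
  · have h3 : ∀ x, ∑ i, (1 / 2 : ℂ) • (T x ⊗ₖ E i + ((p x : ℂ) • R) ⊗ₖ (1 - E i)) =
        (1 / 2 : ℂ) • ((T x + (p x : ℂ) • R) ⊗ₖ 1) := by
      intro x
      ext a b
      have h4 := congrFun₂ hEsum a.2 b.2
      simp only [Fin.sum_univ_two, Matrix.add_apply, Matrix.sub_apply, Matrix.smul_apply,
        kroneckerMap_apply, smul_eq_mul] at h4 ⊢
      linear_combination (1 / 2 * (T x a.1 b.1 - p x * R a.1 b.1)) * h4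
    rw [Fintype.sum_prod_type]
    simp only [h3]
    have h4 : ∑ x, (T x + (p x : ℂ) • R) = (M : ℂ)⁻¹ • 1 := by
      rw [Finset.sum_add_distrib, ← Finset.sum_smul, hpsum, one_smul]
      simp [R]
    have h5 : ∑ x, (T x + (p x : ℂ) • R) ⊗ₖ (1 : Matrix (Fin 2) (Fin 2) ℂ) =
        (∑ x, (T x + (p x : ℂ) • R)) ⊗ₖ 1 := by
      ext a b
      simp only [Matrix.sum_apply, kroneckerMap_apply, Finset.sum_mul]
    rw [← Finset.smul_sum, h5, h4, smul_kronecker, one_kronecker_one, smul_smul, smul_smul]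
    push_cast
    rw [show (2 * (M : ℂ) * (1 / 2) * (M : ℂ)⁻¹) = 1 by field_simp, one_smul]
  · rw [success_tensor_bitChannel]
    congr 1
    ext x a b
    simp only [Fin.sum_univ_two, Matrix.add_apply, submatrix_apply, Matrix.smul_apply,
      kroneckerMap_apply, Matrix.sub_apply, E]
    simp
    ring

lemma successValues_tensor_bitChannel {M : ℕ} (hM : 1 ≤ M) (W : CQChannel X d) :
    successValues {B | B.IsHermitian} (2 * M) (W.tensor bitChannel) =
      successValues {B | B.PosSemidef} M W :=
  Set.ext fun _ => ⟨success_tensor_mem, mem_success_tensor hM⟩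

end BitChannel

/-! ### The meta-converse as a feasible family -/

section MetaConverseValue

variable {X d : Type*} [Fintype X] [Fintype d]

lemma log_le_neg_log_ofReal {r t : ℝ} (hr : 0 < r) :
    ((Real.log r : ℝ) : EReal) ≤ -ENNReal.log (ENNReal.ofReal t) ↔ t ≤ r⁻¹ := by
  rw [EReal.le_neg, ← EReal.coe_neg, ← Real.log_inv,
    ← ENNReal.log_ofReal_of_pos (inv_pos.2 hr), ENNReal.log_le_log_iff,
    ENNReal.ofReal_le_ofReal_iff (inv_pos.2 hr).le]

lemma trace_block_mul_re [DecidableEq X] {A : Matrix (X × d) (X × d) ℂ} {p : X → ℝ}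
    {V : X → Matrix d d ℂ}
    (hA : ∀ x i y j, A (x, i) (y, j) = if x = y then (p x : ℂ) * V x i j else 0)
    (O : Matrix (X × d) (X × d) ℂ) : (A * O).trace.re =
      ∑ x, p x * (V x * O.submatrix (Prod.mk x) (Prod.mk x)).trace.re := by
  have : (A * O).trace =
      ∑ x, (p x : ℂ) * (V x * O.submatrix (Prod.mk x) (Prod.mk x)).trace := by
    simp only [trace, diag_apply, mul_apply, Fintype.sum_prod_type, submatrix_apply, hA,
      Finset.mul_sum]
    refine Finset.sum_congr rfl fun x _ => Finset.sum_congr rfl fun i _ => ?_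
    rw [Finset.sum_eq_single x (fun y _ hy => by simp [hy.symm]) (by simp)]
    simp [mul_assoc]
  rw [this, Complex.re_sum]
  exact Finset.sum_congr rfl fun x _ => Complex.re_ofReal_mul _ _

lemma trace_cqState_mul_re [DecidableEq X] (p : X → ℝ) (W : CQChannel X d)
    (O : Matrix (X × d) (X × d) ℂ) : (cqState p W * O).trace.re =
      ∑ x, p x * (W.state x * O.submatrix (Prod.mk x) (Prod.mk x)).trace.re := by
  refine trace_block_mul_re (fun x i y j => ?_) O
  simp only [cqState, Matrix.sum_apply, Matrix.smul_apply, kroneckerMap_apply, smul_eq_mul]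
  by_cases h : x = y
  · subst h
    rw [Finset.sum_eq_single x (fun z _ hz => by simp [hz]) (by simp)]
    simp
  · rw [if_neg h]
    refine Finset.sum_eq_zero fun z _ => ?_
    rw [single_apply_of_ne _ _ _ _ _ (by rintro ⟨rfl, rfl⟩; exact h rfl)]
    simp

lemma trace_prodState_mul_re [DecidableEq X] (p : X → ℝ) (σ : Matrix d d ℂ)
    (O : Matrix (X × d) (X × d) ℂ) : (prodState p σ * O).trace.re =
      ∑ x, p x * (σ * O.submatrix (Prod.mk x) (Prod.mk x)).trace.re := by
  refine trace_block_mul_re (V := fun _ => σ) (fun x i y j => ?_) O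
  by_cases h : x = y
  · subst h
    simp [prodState]
  · simp [prodState, h]

/-- Normalise `B` by its trace; if the trace is zero, then `B = 0`. -/
lemma trace_mul_re_le_of_densityMatrices {S : Matrix d d ℂ} {c : ℝ}
    (h : ∀ σ ∈ densityMatrices d, (σ * S).trace.re ≤ c) {B : Matrix d d ℂ} (hB : B.PosSemidef) :
    (B * S).trace.re ≤ c * B.trace.re := by
  have h0 := Complex.le_def.1 hB.trace_nonneg
  have htr : B.trace = ((B.trace.re : ℝ) : ℂ) := Complex.ext rfl h0.2.symm
  rcases (show 0 ≤ B.trace.re from h0.1).eq_or_lt with h1 | h1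
  · rw [← h1, Complex.ofReal_zero, hB.trace_eq_zero_iff] at htr
    simp [htr]
  · have h2 := h ((B.trace.re)⁻¹ • B) ⟨PosSemidef.smul hB (inv_pos.2 h1).le, by
      rw [trace_smul, htr, Complex.real_smul, Complex.ofReal_re, ← Complex.ofReal_mul,
        inv_mul_cancel₀ h1.ne', Complex.ofReal_one]⟩
    rw [smul_mul_assoc, trace_smul, Complex.smul_re, smul_eq_mul, inv_mul_le_iff₀ h1] at h2
    linarith

lemma convex_isHermitian {d : Type*} : Convex ℝ {A : Matrix d d ℂ | A.IsHermitian} := by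
  intro A hA B hB a b _ _ _
  exact (IsHermitian.smul hA (IsSelfAdjoint.all a)).add (IsHermitian.smul hB (IsSelfAdjoint.all b))

lemma convex_densityMatrices {d : Type*} [Fintype d] : Convex ℝ (densityMatrices d) := by
  intro ρ hρ τ hτ a b ha hb hab
  refine ⟨convex_posSemidef hρ.1 hτ.1 ha hb hab, ?_⟩
  rw [trace_add, trace_smul, trace_smul, hρ.2, hτ.2]
  simp only [Complex.real_smul, mul_one]
  exact_mod_cast hab

variable [DecidableEq d]

lemma eq_zero_of_mem_subtests {X d : Type*} [DecidableEq d] {p : X → ℝ} {T : X → Matrix d d ℂ}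
    (hT : T ∈ subtests p) {x : X} (hx : p x = 0) : T x = 0 := by
  ext i j
  have := norm_apply_le_of_posSemidef (hT x).1 (hT x).2 i j
  rw [hx] at this
  simpa using this

lemma submatrix_mem_subtests {X d : Type*} [DecidableEq X] [DecidableEq d] {p : X → ℝ} (hp : ∀ x, 0 ≤ p x)
    {O : Matrix (X × d) (X × d) ℂ} (hO : O.PosSemidef) (hO' : (1 - O).PosSemidef) :
    (fun x => (p x : ℂ) • O.submatrix (Prod.mk x) (Prod.mk x)) ∈ subtests p := by
  refine fun x => ⟨(hO.submatrix _).smul (Complex.zero_le_real.2 (hp x)), ?_⟩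
  have h := (hO'.submatrix (Prod.mk x)).smul (Complex.zero_le_real.2 (hp x))
  have h' : (p x : ℂ) • (1 : Matrix d d ℂ) - (p x : ℂ) • O.submatrix (Prod.mk x) (Prod.mk x) =
      (p x : ℂ) • (1 - O).submatrix (Prod.mk x) (Prod.mk x) := by
    ext i j
    simp [one_apply, mul_sub]
  rw [h']
  exact h

/-- The test is block diagonal with blocks `T x / p x`. Where `p x = 0` the bounds force `T x = 0`,
so the default inverse `0` causes no loss. -/
lemma exists_test_of_mem_subtests [DecidableEq X] {p : X → ℝ} (hp : ∀ x, 0 ≤ p x)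
    {T : X → Matrix d d ℂ} (hT : T ∈ subtests p) : ∃ O : Matrix (X × d) (X × d) ℂ,
      O.PosSemidef ∧ (1 - O).PosSemidef ∧
      ∀ x, (p x : ℂ) • O.submatrix (Prod.mk x) (Prod.mk x) = T x := by
  have hpc : ∀ x, 0 ≤ ((p x : ℂ))⁻¹ := fun x => by
    rw [← Complex.ofReal_inv]
    exact Complex.zero_le_real.2 (inv_nonneg.2 (hp x))
  refine ⟨(blockDiagonal fun x => ((p x : ℂ))⁻¹ • T x).submatrix Prod.swap Prod.swap,
    (posSemidef_blockDiagonal fun x => (hT x).1.smul (hpc x)).submatrix _, ?_, fun x => ?_⟩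
  · have h : (1 : Matrix (X × d) (X × d) ℂ) -
        (blockDiagonal fun x => ((p x : ℂ))⁻¹ • T x).submatrix Prod.swap Prod.swap =
        (blockDiagonal fun x => 1 - ((p x : ℂ))⁻¹ • T x).submatrix Prod.swap Prod.swap := by
      ext ⟨x, i⟩ ⟨y, j⟩
      by_cases hxy : x = y <;> simp [blockDiagonal_apply, one_apply, hxy]
    rw [h]
    refine (posSemidef_blockDiagonal fun x => ?_).submatrix _
    by_cases hx : p x = 0
    · rw [eq_zero_of_mem_subtests hT hx, smul_zero, sub_zero]
      exact PosSemidef.one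
    · have h1 := (hT x).2.smul (hpc x)
      rwa [smul_sub, smul_smul, inv_mul_cancel₀ (by exact_mod_cast hx), one_smul] at h1
  · ext i j
    by_cases hx : p x = 0
    · simp [eq_zero_of_mem_subtests hT hx, hx]
    · have : (p x : ℂ) ≠ 0 := by exact_mod_cast hx
      simp [blockDiagonal_apply, this]

lemma smul_mem_subtests {X d : Type*} [DecidableEq d] {p : X → ℝ} (hp : ∀ x, 0 ≤ p x)
    {T : X → Matrix d d ℂ} (hT : T ∈ subtests p) {r : ℝ} (hr : 0 ≤ r) (hr1 : r ≤ 1) :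
    r • T ∈ subtests p := by
  have h0 : (0 : X → Matrix d d ℂ) ∈ subtests p := fun x =>
    ⟨PosSemidef.zero, by simpa using ofReal_smul_one_posSemidef (hp x)⟩
  simpa using convex_subtests p hT h0 hr (sub_nonneg.2 hr1) (by ring)

lemma log_le_hypothesisTestingEntropy [DecidableEq X] {M : ℕ} (hM : 1 ≤ M)
    {W : CQChannel X d} {p : X → ℝ} (hp : ∀ x, 0 ≤ p x)
    {T : X → Matrix d d ℂ} (hT : T ∈ subtests p) (hTM : (1 - (M : ℂ) • ∑ x, T x).PosSemidef)
    {σ : Matrix d d ℂ} (hσ : σ ∈ densityMatrices d) :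
    ((Real.log M : ℝ) : EReal) ≤
      hypothesisTestingEntropy (1 - success W T) (cqState p W) (prodState p σ) := by
  have hM0 : (0 : ℝ) < M := by exact_mod_cast hM
  rw [hypothesisTestingEntropy, log_le_neg_log_ofReal hM0]
  obtain ⟨O, hO, hO', hOT⟩ := exists_test_of_mem_subtests hp hT
  have hval : ∀ V : X → Matrix d d ℂ,
      ∑ x, p x * (V x * O.submatrix (Prod.mk x) (Prod.mk x)).trace.re =
        ∑ x, (V x * T x).trace.re := fun V => Finset.sum_congr rfl fun x _ => by
    rw [← hOT, mul_smul_comm, trace_smul, smul_eq_mul, Complex.re_ofReal_mul]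
  refine le_trans (csInf_le (a := (prodState p σ * O).trace.re) ⟨0, ?_⟩
    ⟨O, hO, hO', ?_, rfl⟩) ?_
  · rintro _ ⟨Q, hQ, -, -, rfl⟩
    rw [trace_prodState_mul_re]
    exact Finset.sum_nonneg fun x _ =>
      mul_nonneg (hp x) (trace_mul_re_nonneg hσ.1 (hQ.submatrix _))
  · rw [trace_cqState_mul_re, hval, success, sub_sub_cancel]
  · rw [trace_prodState_mul_re, hval fun _ => σ]
    have h := trace_mul_re_nonneg hσ.1 hTM
    rw [← neg_sub, mul_neg, trace_neg, Complex.neg_re, trace_mul_constraint_re, hσ.2,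
      Complex.one_re] at h
    rw [inv_eq_one_div, le_div_iff₀ hM0]
    linarith

/-- A uniform bound on the optimal type-II errors yields a single family of subtests. -/
lemma exists_subtests_of_forall_entropy [DecidableEq X] {W : CQChannel X d} {p : X → ℝ}
    (hp : p ∈ stdSimplex ℝ X) {ε r c : ℝ} (hε : 0 ≤ ε) (hr : 0 < r) (hc : r⁻¹ < c)
    (h : ∀ σ ∈ densityMatrices d, ((Real.log r : ℝ) : EReal) ≤
      hypothesisTestingEntropy ε (cqState p W) (prodState p σ)) :
    ∃ T ∈ subtests p, 1 - ε ≤ success W T ∧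
      ∀ σ ∈ densityMatrices d, (σ * ∑ x, T x).trace.re ≤ c := by
  have hX : Nonempty X := by
    by_contra hX
    rw [not_nonempty_iff] at hX
    simpa using hp.2
  -- The entropy bound offers a test depending on `σ`; minimax makes it uniform. The gap `r⁻¹ < c`
  -- avoids needing the optimal test to be attained.
  obtain ⟨T, ⟨hT, hTε⟩, hTσ⟩ := exists_forall_nonpos_of_forall_exists
    (s := subtests p ∩ {T | 1 - ε ≤ success W T}) (t := densityMatrices d)
    ((isCompact_subtests p).inter_right (isClosed_le continuous_const (continuous_success W)))
    ((convex_subtests p).inter fun T hT T' hT' a b ha hb hab => by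
      simp only [Set.mem_ofPred_eq, success_combo] at *
      calc 1 - ε = a * (1 - ε) + b * (1 - ε) := by rw [← add_mul, hab, one_mul]
        _ ≤ _ := by gcongr)
    ⟨_, W.state_mem (Classical.arbitrary X)⟩
    (fun T σ => (σ * ∑ x, T x).trace.re - c)
    (fun σ _ => by
      have : Continuous fun T : X → Matrix d d ℂ => (σ * ∑ x, T x).trace := by fun_prop
      exact (Complex.continuous_re.comp this).sub continuous_const)
    (fun σ _ T T' a b _ _ hab => by
      simp only [Pi.add_apply, Pi.smul_apply, Finset.sum_add_distrib, ← Finset.smul_sum,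
        trace_mul_combo_re]
      linear_combination c * hab)
    (fun T _ => ⟨convex_densityMatrices, fun σ _ σ' _ a b _ _ hab => by
      simp only [trace_combo_mul_re, smul_eq_mul]
      exact le_of_eq (by linear_combination (-c) * hab)⟩)
    (fun σ hσ => by
      have h1 := h σ hσ
      rw [hypothesisTestingEntropy, log_le_neg_log_ofReal hr] at h1
      obtain ⟨_, ⟨O, hO, hO', hOε, rfl⟩, hOc⟩ := exists_lt_of_csInf_lt
        (by
          refine ⟨_, 1, PosSemidef.one, by simpa using PosSemidef.zero, ?_, rfl⟩
          rw [trace_cqState_mul_re]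
          have : ∀ x, (1 : Matrix (X × d) (X × d) ℂ).submatrix (Prod.mk x) (Prod.mk x) = 1 :=
            fun x => submatrix_one _ (Prod.mk_right_injective x)
          simp [this, (W.state_mem _).2, hp.2, hε]) (h1.trans_lt hc)
      refine ⟨_, ⟨submatrix_mem_subtests hp.1 hO hO', ?_⟩, ?_⟩
      · rw [trace_cqState_mul_re] at hOε
        simpa [success, mul_smul_comm, trace_smul] using hOε
      · rw [trace_prodState_mul_re] at hOc
        rw [sub_nonpos]
        simpa [Matrix.mul_sum, trace_sum, mul_smul_comm, trace_smul] using hOc.le)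
  exact ⟨T, hT, hTε, fun σ hσ => sub_nonpos.1 (hTσ σ hσ)⟩

theorem epsMC_eq [DecidableEq X] [Nonempty X] {M : ℕ} (hM : 1 ≤ M) (W : CQChannel X d) :
    epsMC M W = 1 - sSup (successValues {B | B.PosSemidef} M W) := by
  have hM0 : (0 : ℝ) < M := by exact_mod_cast hM
  set S := sSup (successValues {B | B.PosSemidef} M W) with hS
  have hne := successValues_nonempty {B | B.PosSemidef} hM W
  have hbdd := bddAbove_successValues {B | B.PosSemidef} M W
  have hS1 : S ≤ 1 := csSup_le hne (by
    rintro _ ⟨p, hp, T, hT, -, rfl⟩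
    exact success_le_one W hp hT)
  have hmem : ∀ s ∈ successValues {B | B.PosSemidef} M W,
      1 - s ∈ {ε : ℝ | ε ∈ Set.Icc (0 : ℝ) 1 ∧
        ((Real.log M : ℝ) : EReal) ≤ ⨆ p : stdSimplex ℝ X, ⨅ σ : densityMatrices d,
          hypothesisTestingEntropy ε (cqState p W) (prodState p (σ : Matrix d d ℂ))} := by
    intro s hs
    rw [mem_successValues_posSemidef] at hs
    obtain ⟨p, hp, T, hT, hTM, rfl⟩ := hs
    refine ⟨⟨sub_nonneg.2 (success_le_one W hp hT), sub_le_self _ (success_nonneg W hT)⟩, ?_⟩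
    exact le_trans (le_iInf fun σ => log_le_hypothesisTestingEntropy hM hp.1 hT hTM σ.2)
      (le_iSup (fun p : stdSimplex ℝ X => ⨅ σ : densityMatrices d,
        hypothesisTestingEntropy (1 - success W T) (cqState p W)
          (prodState p (σ : Matrix d d ℂ))) ⟨p, hp⟩)
  refine le_antisymm ?_ (le_csInf (hne.elim fun s hs => ⟨_, hmem s hs⟩) ?_)
  · rw [le_sub_comm]
    refine csSup_le hne fun s hs => ?_
    rw [le_sub_comm]
    exact csInf_le ⟨0, fun ε hε => hε.1.1⟩ (hmem s hs)
  · rintro ε ⟨⟨hε, -⟩, hsup⟩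
    rw [sub_le_comm]
    refine le_of_forall_pos_le_add fun δ hδ => ?_
    -- Half of `δ` pays for a nearly optimal `p`, the rest for the strict gap `r⁻¹ < (1 + δ) / M`.
    have hr : 0 < (M : ℝ) / (1 + δ / 2) := by positivity
    have hlog : ((Real.log (M / (1 + δ / 2)) : ℝ) : EReal) < ((Real.log M : ℝ) : EReal) := by
      rw [EReal.coe_lt_coe_iff]
      exact Real.log_lt_log hr (div_lt_self hM0 (by linarith))
    obtain ⟨p, hp⟩ := lt_iSup_iff.1 (hlog.trans_le hsup)
    obtain ⟨T, hT, hTε, hTσ⟩ := exists_subtests_of_forall_entropy (c := (1 + δ) / M) p.2 hε hr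
      (by rw [inv_div]; gcongr; linarith) fun σ hσ => le_iInf_iff.1 hp.le ⟨σ, hσ⟩
    have hδ1 : 0 < 1 + δ := by linarith
    -- The family violates `M ∑ T x ≼ 1` by at most a factor `1 + δ`, so shrinking it restores
    -- feasibility.
    have hle : success W ((1 + δ)⁻¹ • T) ≤ S := by
      refine le_csSup hbdd ⟨p, p.2, _, smul_mem_subtests p.2.1 hT (inv_nonneg.2 hδ1.le)
        (inv_le_one_of_one_le₀ (by linarith)), fun B hB => ?_, rfl⟩
      have h1 := trace_mul_re_le_of_densityMatrices hTσ hB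
      have h2 : ∑ x, (B * ((1 + δ)⁻¹ • T) x).trace.re =
          (1 + δ)⁻¹ * (B * ∑ x, T x).trace.re := by
        simp only [Pi.smul_apply, mul_smul_comm, trace_smul, Complex.smul_re, smul_eq_mul,
          trace_sum, Complex.re_sum, Finset.mul_sum]
      rw [trace_mul_constraint_re, h2, sub_nonpos]
      calc (M : ℝ) * ((1 + δ)⁻¹ * (B * ∑ x, T x).trace.re)
          ≤ M * ((1 + δ)⁻¹ * ((1 + δ) / M * B.trace.re)) := by gcongr
        _ = B.trace.re := by field_simp
    have h3 : success W ((1 + δ)⁻¹ • T) = (1 + δ)⁻¹ * success W T := by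
      simpa using success_combo W T 0 (1 + δ)⁻¹ 0
    rw [h3, inv_mul_le_iff₀ hδ1] at hle
    -- The bound `(1 + δ) * S ≤ S + δ` uses `S ≤ 1`.
    nlinarith

end MetaConverseValue

end CQ

end

theorem mainTheorem2 {X d : Type*} [Fintype X] [DecidableEq X] [Nonempty X]
    [Fintype d] [DecidableEq d] (W : CQ.CQChannel X d) (M : ℕ) (hM : 1 ≤ M) :
    CQ.epsNS (2 * M) (W.tensor CQ.bitChannel) = CQ.epsMC M W ∧
    ((CQ.epsMC M W : ℝ) : EReal) =
      (⨅ p : stdSimplex ℝ X, ⨆ B : {B : Matrix d d ℂ // B.PosSemidef},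
        ((CQ.dualObjective M W p B : ℝ) : EReal)) ∧
    ((CQ.epsNS M W : ℝ) : EReal) =
      (⨅ p : stdSimplex ℝ X, ⨆ B : {B : Matrix d d ℂ // B.IsHermitian},
        ((CQ.dualObjective M W p B : ℝ) : EReal)) := by
  refine ⟨?_, ?_, ?_⟩
  · rw [CQ.epsNS_eq (by omega), CQ.epsMC_eq hM, CQ.successValues_tensor_bitChannel hM]
  · rw [CQ.epsMC_eq hM]
    exact CQ.one_sub_sSup_successValues (C := {B | B.PosSemidef}) (fun B hB => hB.isHermitian)
      Matrix.PosSemidef.zero CQ.convex_posSemidef (fun B hB r hr => Matrix.PosSemidef.smul hB hr)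
      hM W
  · rw [CQ.epsNS_eq hM]
    exact CQ.one_sub_sSup_successValues (C := {B | B.IsHermitian}) (fun B hB => hB)
      Matrix.isHermitian_zero CQ.convex_isHermitian
      (fun B hB r _ => hB.smul (IsSelfAdjoint.all r)) hM W
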